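/- Let $\mathbb{K}$ be a field and let $G$ be a finite simple graph with vertex set $V(G)$ and edge set $E(G)$. Let $S=\mathbb{K}[x_v,y_v : v\in V(G)]$, graded by $\deg x_v=\deg y_v=1$, and let $$\mathcal{I}_G=(x_ux_v-y_uy_v : \{u,v\}\in E(G))\subset S$$ be the parity binomial edge ideal of $G$. Let $H$ be an induced subgraph of $G$, let $S_H=\mathbb{K}[x_v,y_v : v\in V(H)]$ with the same grading, and let $\mathcal{I}_H\subset S_H$ be the parity binomial edge ideal of $H$. For a standard graded polynomial ring $R$ over $\mathbb{K}$ in finitely many variables and a finitely generated graded $R$-module $M$, let $\beta_{i,j}^R(M)$ denote the $(i,j)$-th graded Betti number of $M$, that is, the number of summands $R(-j)$ in the $i$-th free module of the minimal graded free resolution of $M$ over $R$. Then $$\beta_{i,j}^{S_H}(S_H/\mathcal{I}_H)\le \beta_{i,j}^{S}(S/\mathcal{I}_G)\qquad\text{for all integers } i\ge 0 \text{ and } j.$$ -/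

import Mathlib

noncomputable section

namespace ParityBinomial

open MvPolynomial

/-- The `ℤ`-graded piece of degree `j` of the standard graded polynomial ring `K[X_s : s ∈ σ]`,
in which every variable has degree `1` (it is zero for `j < 0`). -/
def stdGrading (K σ : Type*) [Field K] (j : ℤ) : Submodule K (MvPolynomial σ K) :=
  weightedHomogeneousSubmodule K (fun _ : σ => (1 : ℤ)) j

/-- The graded piece of degree `j` of the graded free module `⨁ₖ R(-d k)`, `R = K[X_s : s ∈ σ]`.
As usual `R(-a)_j = R_{j-a}`, so that the `k`-th basis vector has degree `d k`. -/
def freeGrading (K σ : Type*) [Field K] {r : ℕ} (d : Fin r → ℤ) (j : ℤ) :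
    Submodule K (Fin r → MvPolynomial σ K) :=
  Submodule.pi Set.univ fun k => stdGrading K σ (j - d k)

/-- A minimal graded free resolution
`⋯ ⟶ ⨁ₖ R(-deg 1 k) ⟶ ⨁ₖ R(-deg 0 k) ⟶ M ⟶ 0` of an `R`-module `M` with graded pieces `ℳ j`,
where `R = K[X_s : s ∈ σ]` is the standard graded polynomial ring. All free modules have finite
rank, all maps are `R`-linear and graded of degree `0`, the sequence is exact, and the image of
every differential lies in `𝔪 F`, with `𝔪` the ideal generated by the variables. -/
structure MinGradedFreeRes {K σ M : Type*} [Field K] [AddCommGroup M] [Module K M]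
    [Module (MvPolynomial σ K) M] (ℳ : ℤ → Submodule K M) where
  /-- the rank of the `i`-th free module -/
  rank : ℕ → ℕ
  /-- the degrees of the basis vectors of the `i`-th free module -/
  deg : ∀ i, Fin (rank i) → ℤ
  /-- the differential from the `(i+1)`-st to the `i`-th free module -/
  diff : ∀ i, (Fin (rank (i + 1)) → MvPolynomial σ K) →ₗ[MvPolynomial σ K]
    (Fin (rank i) → MvPolynomial σ K)
  /-- the augmentation -/
  aug : (Fin (rank 0) → MvPolynomial σ K) →ₗ[MvPolynomial σ K] M
  diff_mem : ∀ i j, ∀ v ∈ freeGrading K σ (deg (i + 1)) j, diff i v ∈ freeGrading K σ (deg i) j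
  aug_mem : ∀ j, ∀ v ∈ freeGrading K σ (deg 0) j, aug v ∈ ℳ j
  aug_surjective : Function.Surjective aug
  exact_aug : Function.Exact (diff 0) aug
  exact_diff : ∀ i, Function.Exact (diff (i + 1)) (diff i)
  minimal : ∀ i v k, diff i v k ∈ Ideal.span (Set.range (X : σ → MvPolynomial σ K))

/-- The number of summands `R(-j)` in the `i`-th free module of the resolution. -/
def MinGradedFreeRes.betti {K σ M : Type*} [Field K] [AddCommGroup M] [Module K M]
    [Module (MvPolynomial σ K) M] {ℳ : ℤ → Submodule K M}
    (F : MinGradedFreeRes (σ := σ) ℳ) (i : ℕ) (j : ℤ) : ℕ :=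
  Fintype.card {k : Fin (F.rank i) // F.deg i k = j}

open scoped Classical in
/-- The graded Betti number `β_{i,j}^R(M)` over `R = K[X_s : s ∈ σ]`, `σ` finite, of a finitely
generated graded `R`-module `M` with graded pieces `ℳ j`: the number of summands `R(-j)` in the
`i`-th module of a minimal graded free resolution of `M`. Such a resolution always exists and is
unique up to isomorphism. -/
def gradedBetti (K σ : Type*) {M : Type*} [Field K] [AddCommGroup M] [Module K M]
    [Module (MvPolynomial σ K) M] (ℳ : ℤ → Submodule K M) (i : ℕ) (j : ℤ) : ℕ :=
  if h : Nonempty (MinGradedFreeRes (σ := σ) ℳ) then h.some.betti i j else 0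

/-- The grading of `R / I` induced by the standard grading of `R`: the image of `R_j`. -/
def quotientGrading {K σ : Type*} [Field K] (I : Ideal (MvPolynomial σ K)) (j : ℤ) :
    Submodule K (MvPolynomial σ K ⧸ I) :=
  (stdGrading K σ j).map (Ideal.Quotient.mkₐ K I).toLinearMap

/-- The polynomial ring `K[x_v, y_v : v ∈ V]`; the variable `x_v` is `X (Sum.inl v)` and `y_v` is
`X (Sum.inr v)`. -/
abbrev XYRing (K V : Type*) [Field K] : Type _ := MvPolynomial (V ⊕ V) K

/-- The parity binomial edge ideal `(x_u x_v - y_u y_v : {u, v} ∈ E(G))` of `G`. -/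
def parityIdeal (K : Type*) {V : Type*} [Field K] (G : SimpleGraph V) : Ideal (XYRing K V) :=
  Ideal.span {f | ∃ u v, G.Adj u v ∧
    f = X (Sum.inl u) * X (Sum.inl v) - X (Sum.inr u) * X (Sum.inr v)}

/-- The graded Betti number `β_{i,j}^S(S / 𝓘_G)`, where `S = K[x_v, y_v : v ∈ V(G)]`. -/
def parityBetti (K : Type*) {V : Type*} [Field K] (G : SimpleGraph V) (i : ℕ) (j : ℤ) : ℕ :=
  gradedBetti K (V ⊕ V) (quotientGrading (parityIdeal K G)) i j

end ParityBinomial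

end

noncomputable section

namespace ParityBinomial

open MvPolynomial

/-! Write `S_H = K[x_v, y_v : v ∈ A]` for the induced subgraph on `A`. The inclusion of `S_H` in `S`
and the map `S → S_H` killing the variables outside `A` are graded, compose to the identity of
`S_H`, and respect the two parity ideals (`inclusion_mem_parityIdeal`,
`retraction_mem_parityIdeal`). Hence `S_H / I_H` is a graded retract of `S / I_G`.

Betti numbers cannot grow under such a retract (`betti_le_of_retract`). The two quotient maps lift
to semilinear maps `f`, `g` between minimal resolutions, and `g ∘ f` is homotopic to the identity
(`exists_comparison`). Minimality kills the homotopy terms modulo the maximal ideal, so there `g ∘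
f` is the identity. As `f` is graded, its matrix of constant terms is block diagonal by degree; the
degree `j` block has a left inverse, which bounds the number of its columns
(`card_le_card_of_comp_congr_id`). Lifting uses only freeness of the source and exactness of the
target, so no base change or flatness enters.

The comparison holds for any two minimal resolutions, so the one picked by `gradedBetti` does not
matter, but its existence does: it is obtained by iterating minimal homogeneous covers of syzygies
(`nonempty_minGradedFreeRes_quotient`). -/

/-! ### Homogeneous components in graded modules -/

/-- Additive projections onto the graded pieces `ℳ j` of a `ℤ`-graded module. -/
structure Projections {K M : Type*} [Field K] [AddCommGroup M] [Module K M]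
    (ℳ : ℤ → Submodule K M) where
  /-- the projection onto the piece of degree `j` -/
  proj : ℤ → M →+ M
  proj_same : ∀ j, ∀ m ∈ ℳ j, proj j m = m
  proj_ne : ∀ i j, i ≠ j → ∀ m ∈ ℳ i, proj j m = 0
  iSup_eq_top : ⨆ j, ℳ j = ⊤

namespace Projections

variable {K M N : Type*} [Field K] [AddCommGroup M] [Module K M] [AddCommGroup N] [Module K N]
  {ℳ : ℤ → Submodule K M} {𝒩 : ℤ → Submodule K N}

theorem induction (P : Projections ℳ) {p : M → Prop} (m : M) (hom : ∀ i, ∀ x ∈ ℳ i, p x)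
    (zero : p 0) (add : ∀ x y, p x → p y → p (x + y)) : p m :=
  Submodule.iSup_induction ℳ (motive := p) (by rw [P.iSup_eq_top]; trivial) hom zero add

theorem proj_mem (P : Projections ℳ) (j : ℤ) (m : M) : P.proj j m ∈ ℳ j := by
  refine P.induction (p := fun m => P.proj j m ∈ ℳ j) m (fun i x hx => ?_) (by simp)
    fun x y hx hy => by simpa using add_mem hx hy
  by_cases h : i = j
  · subst h; rwa [P.proj_same _ _ hx]
  · simp [P.proj_ne _ _ h _ hx]

theorem map_proj_add (P : Projections ℳ) (Q : Projections 𝒩) (φ : M →+ N) (e : ℤ)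
    (h : ∀ i, ∀ m ∈ ℳ i, φ m ∈ 𝒩 (i + e)) (j : ℤ) (m : M) :
    φ (P.proj j m) = Q.proj (j + e) (φ m) := by
  refine P.induction (p := fun m => φ (P.proj j m) = Q.proj (j + e) (φ m)) m
    (fun i x hx => ?_) (by simp) fun x y hx hy => by simp [hx, hy]
  by_cases hij : i = j
  · subst hij; rw [P.proj_same _ _ hx, Q.proj_same _ _ (h _ _ hx)]
  · rw [P.proj_ne _ _ hij _ hx, Q.proj_ne _ _ (by simpa using hij) _ (h _ _ hx), map_zero]

theorem map_proj (P : Projections ℳ) (Q : Projections 𝒩) (φ : M →+ N)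
    (h : ∀ i, ∀ m ∈ ℳ i, φ m ∈ 𝒩 i) (j : ℤ) (m : M) :
    φ (P.proj j m) = Q.proj j (φ m) := by
  simpa using P.map_proj_add Q φ 0 (by simpa using h) j m

/-- A graded map commutes with projections, so the degree `j` component of any preimage is again a
preimage. This turns exactness into exactness in each degree. -/
theorem exists_mem_of_mem (P : Projections ℳ) (Q : Projections 𝒩) (φ : M →+ N)
    (h : ∀ i, ∀ m ∈ ℳ i, φ m ∈ 𝒩 i) {j : ℤ} {y : N} (hy : y ∈ 𝒩 j) (hx : ∃ x, φ x = y) :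
    ∃ x ∈ ℳ j, φ x = y := by
  obtain ⟨x, rfl⟩ := hx
  exact ⟨P.proj j x, P.proj_mem j x, by rw [P.map_proj Q φ h, Q.proj_same _ _ hy]⟩

theorem exists_sum_proj (P : Projections ℳ) (m : M) :
    ∃ s : Finset ℤ, ∑ j ∈ s, P.proj j m = m := by
  -- Allowing every larger index set makes the claim additive: for a sum, take the union of the two
  -- sets.
  suffices h : ∃ s : Finset ℤ, ∀ t, s ⊆ t → ∑ j ∈ t, P.proj j m = m from
    ⟨h.choose, h.choose_spec _ subset_rfl⟩
  refine P.induction (p := fun m => ∃ s : Finset ℤ, ∀ t, s ⊆ t → ∑ j ∈ t, P.proj j m = m) m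
    (fun i x hx => ⟨{i}, fun t ht => ?_⟩) ⟨∅, by simp⟩ ?_
  · rw [Finset.sum_eq_single_of_mem i (ht (Finset.mem_singleton_self i))
      fun j _ hj => P.proj_ne _ _ hj.symm _ hx, P.proj_same _ _ hx]
  · rintro x y ⟨s, hs⟩ ⟨s', hs'⟩
    refine ⟨s ∪ s', fun t ht => ?_⟩
    simp [Finset.sum_add_distrib, hs t (Finset.union_subset_left ht),
      hs' t (Finset.union_subset_right ht)]

end Projections

/-! ### Gradings of polynomial rings, free modules and quotients -/

section Gradings

variable (K σ : Type*) [Field K]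

theorem mul_mem_stdGrading {p q : MvPolynomial σ K} {a b c : ℤ} (hp : p ∈ stdGrading K σ a)
    (hq : q ∈ stdGrading K σ b) (h : a + b = c) : p * q ∈ stdGrading K σ c :=
  h ▸ IsWeightedHomogeneous.mul hp hq

theorem X_mem_stdGrading (s : σ) : (X s : MvPolynomial σ K) ∈ stdGrading K σ 1 :=
  isWeightedHomogeneous_X _ _ _

theorem one_mem_stdGrading {a : ℤ} (h : a = 0) : (1 : MvPolynomial σ K) ∈ stdGrading K σ a :=
  h ▸ isWeightedHomogeneous_one _ _

theorem constantCoeff_eq_zero_of_mem_stdGrading {p : MvPolynomial σ K} {a : ℤ}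
    (hp : p ∈ stdGrading K σ a) (ha : a ≠ 0) : constantCoeff p = 0 := by
  by_contra h
  exact ha (by simpa using (hp (d := 0) (by simpa [constantCoeff_eq] using h)).symm)

theorem mem_span_X_iff (p : MvPolynomial σ K) :
    p ∈ Ideal.span (Set.range (X : σ → MvPolynomial σ K)) ↔ constantCoeff p = 0 := by
  have := mem_pow_idealOfVars_iff' (σ := σ) (R := K) 1 p
  rw [pow_one] at this
  rw [this, constantCoeff_eq]
  refine ⟨fun h => h 0 (by simp), fun h x hx => ?_⟩
  rw [Nat.lt_one_iff, Finsupp.degree_eq_zero_iff] at hx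
  rwa [hx]

/-- The homogeneous components of polynomials. -/
def stdProjections : Projections (stdGrading K σ) where
  proj j := (weightedHomogeneousComponent (fun _ : σ => (1 : ℤ)) j).toAddMonoidHom
  proj_same _ _ hm := weightedHomogeneousComponent_eq_self hm
  proj_ne i j hij _ hm := IsWeightedHomogeneous.weightedHomogeneousComponent_ne j hm hij.symm
  iSup_eq_top := by
    have := weightedDecomposition K (fun _ : σ => (1 : ℤ))
    exact (DirectSum.Decomposition.isInternal
      (weightedHomogeneousSubmodule K (fun _ : σ => (1 : ℤ)))).submodule_iSup_eq_top

variable {K σ}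

theorem mem_freeGrading {r : ℕ} {d : Fin r → ℤ} {j : ℤ} {v : Fin r → MvPolynomial σ K} :
    v ∈ freeGrading K σ d j ↔ ∀ k, v k ∈ stdGrading K σ (j - d k) := by
  simp [freeGrading, Submodule.mem_pi]

theorem single_mem_freeGrading {r : ℕ} {d : Fin r → ℤ} {j : ℤ} (k : Fin r)
    {p : MvPolynomial σ K} (hp : p ∈ stdGrading K σ (j - d k)) :
    Pi.single k p ∈ freeGrading K σ d j := by
  rw [mem_freeGrading]
  intro l
  by_cases h : l = k
  · subst h; simpa
  · simp [h]

theorem smul_mem_freeGrading {r : ℕ} {d : Fin r → ℤ} {a b c : ℤ} {p : MvPolynomial σ K}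
    {v : Fin r → MvPolynomial σ K} (hp : p ∈ stdGrading K σ a) (hv : v ∈ freeGrading K σ d b)
    (h : a + b = c) : p • v ∈ freeGrading K σ d c := by
  rw [mem_freeGrading] at *
  exact fun k => mul_mem_stdGrading K σ hp (hv k) (by omega)

variable (K σ) in
/-- The homogeneous components of elements of a graded free module. -/
def freeProjections {r : ℕ} (d : Fin r → ℤ) : Projections (freeGrading K σ d) where
  proj j :=
    { toFun := fun v k => (stdProjections K σ).proj (j - d k) (v k)
      map_zero' := by ext1; simp
      map_add' := fun v w => by ext1; simp }
  proj_same j m hm := by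
    rw [mem_freeGrading] at hm
    ext1 k
    exact (stdProjections K σ).proj_same _ _ (hm k)
  proj_ne i j hij m hm := by
    rw [mem_freeGrading] at hm
    ext1 k
    exact (stdProjections K σ).proj_ne _ _ (by simpa using hij) _ (hm k)
  iSup_eq_top := by
    rw [eq_top_iff]
    rintro v -
    rw [← Finset.univ_sum_single v]
    refine sum_mem fun k _ => (stdProjections K σ).induction (p := fun q =>
      Pi.single k q ∈ ⨆ j, freeGrading K σ d j) (v k) (fun i x hx => ?_) (by simp) ?_
    · exact Submodule.mem_iSup_of_mem (i + d k) (single_mem_freeGrading k (by simpa using hx))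
    · intro x y hx hy
      rw [Pi.single_add]
      exact add_mem hx hy

/-- The grading of the quotient by an ideal that is closed under homogeneous components. -/
def quotientProjections (I : Ideal (MvPolynomial σ K))
    (hI : ∀ p ∈ I, ∀ j, (stdProjections K σ).proj j p ∈ I) :
    Projections (quotientGrading I) := by
  have hsurj : Function.Surjective (Ideal.Quotient.mk I).toAddMonoidHom :=
    Ideal.Quotient.mk_surjective
  let π (j : ℤ) : (MvPolynomial σ K ⧸ I) →+ (MvPolynomial σ K ⧸ I) :=
    (Ideal.Quotient.mk I).toAddMonoidHom.liftOfSurjective hsurj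
      ⟨(Ideal.Quotient.mk I).toAddMonoidHom.comp ((stdProjections K σ).proj j), fun p hp =>
        Ideal.Quotient.eq_zero_iff_mem.2 (hI p (Ideal.Quotient.eq_zero_iff_mem.1 hp) j)⟩
  have hπ (j : ℤ) (p : MvPolynomial σ K) : π j (Ideal.Quotient.mk I p) =
      Ideal.Quotient.mk I ((stdProjections K σ).proj j p) :=
    AddMonoidHom.liftOfRightInverse_comp_apply _ _ _ _ p
  exact
  { proj := π
    proj_same := by
      rintro j _ ⟨p, hp, rfl⟩
      exact (hπ j p).trans (by rw [(stdProjections K σ).proj_same _ _ hp]; rfl)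
    proj_ne := by
      rintro i j hij _ ⟨p, hp, rfl⟩
      exact (hπ j p).trans (by rw [(stdProjections K σ).proj_ne _ _ hij _ hp, map_zero])
    iSup_eq_top := by
      rw [show (⨆ j, quotientGrading I j) =
        (⨆ j, stdGrading K σ j).map (Ideal.Quotient.mkₐ K I).toLinearMap from
          (Submodule.map_iSup _ _).symm, (stdProjections K σ).iSup_eq_top, Submodule.map_top,
        LinearMap.range_eq_top]
      exact Ideal.Quotient.mkₐ_surjective K I }

theorem aeval_mem_stdGrading {τ : Type*} (x : σ → MvPolynomial τ K)
    (hx : ∀ s, x s ∈ stdGrading K τ 1) {j : ℤ} {p : MvPolynomial σ K}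
    (hp : p ∈ stdGrading K σ j) : aeval x p ∈ stdGrading K τ j := by
  refine IsWeightedHomogeneous.induction_on (motive := fun p _ => aeval x p ∈ stdGrading K τ j)
    (by simp) (fun p q _ _ h1 h2 => by simpa using add_mem h1 h2) (fun d a hd => ?_) hp
  rw [aeval_monomial]
  refine mul_mem_stdGrading K τ (isWeightedHomogeneous_C _ a)
    (IsWeightedHomogeneous.prod d.support (fun s => x s ^ d s) (fun s => d s • 1)
      fun s _ => (hx s).pow (d s)) ?_
  rw [← hd, zero_add, Finsupp.weight_apply, Finsupp.sum]

end Gradings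

/-! ### Semilinear maps out of free modules -/

section Lift

variable {R R' N : Type*} [CommRing R] [CommRing R'] [AddCommGroup N] [Module R' N]

/-- The semilinear map from a free module with prescribed values on the standard basis. -/
def freeLift (θ : R →+* R') {r : ℕ} (a : Fin r → N) : (Fin r → R) →ₛₗ[θ] N where
  toFun v := ∑ k, θ (v k) • a k
  map_add' v w := by simp [add_smul, Finset.sum_add_distrib]
  map_smul' c v := by simp [mul_smul, Finset.smul_sum]

theorem freeLift_apply (θ : R →+* R') {r : ℕ} (a : Fin r → N) (v : Fin r → R) :
    freeLift θ a v = ∑ k, θ (v k) • a k := rfl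

theorem semilinear_apply (θ : R →+* R') {r : ℕ} (t : (Fin r → R) →ₛₗ[θ] N) (v : Fin r → R) :
    t v = ∑ k, θ (v k) • t (Pi.single k 1) := by
  conv_lhs => rw [← Finset.univ_sum_single v]
  rw [map_sum]
  refine Finset.sum_congr rfl fun k _ => ?_
  rw [← t.map_smulₛₗ, ← Pi.single_smul, smul_eq_mul, mul_one]

theorem exists_linear_lift {P : Type*} [AddCommGroup P] [Module R' P] {r : ℕ}
    (D : P →ₗ[R'] N) (t : (Fin r → R') →ₗ[R'] N) (h : ∀ v, ∃ x, D x = t v) :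
    ∃ s : (Fin r → R') →ₗ[R'] P, ∀ v, D (s v) = t v := by
  choose a ha using fun k => h (Pi.single k 1)
  refine ⟨freeLift (RingHom.id R') a, fun v => ?_⟩
  rw [semilinear_apply _ t v, freeLift_apply, map_sum]
  simp [ha]

end Lift

/-! ### Graded lifts and comparison of ranks modulo the maximal ideal -/

section GradedLift

variable {K σ τ : Type*} [Field K]

/-- Homogeneous preimages of the values on the basis vectors determine the lift; it is graded
because `θ` preserves degrees. -/
theorem exists_graded_lift {N : Type*} [AddCommGroup N] [Module (MvPolynomial τ K) N]
    (θ : MvPolynomial σ K →+* MvPolynomial τ K)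
    (hθ : ∀ j, ∀ p ∈ stdGrading K σ j, θ p ∈ stdGrading K τ j) {r r' : ℕ} (d : Fin r → ℤ)
    (d' : Fin r' → ℤ) (D : (Fin r' → MvPolynomial τ K) →ₗ[MvPolynomial τ K] N)
    (t : (Fin r → MvPolynomial σ K) →ₛₗ[θ] N)
    (h : ∀ j, ∀ v ∈ freeGrading K σ d j, ∃ x ∈ freeGrading K τ d' j, D x = t v) :
    ∃ f : (Fin r → MvPolynomial σ K) →ₛₗ[θ] (Fin r' → MvPolynomial τ K),
      (∀ j, ∀ v ∈ freeGrading K σ d j, f v ∈ freeGrading K τ d' j) ∧ ∀ v, D (f v) = t v := by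
  choose a ha hDa using fun k => h (d k) (Pi.single k 1)
    (single_mem_freeGrading k (one_mem_stdGrading K σ (sub_self _)))
  refine ⟨freeLift θ a, fun j v hv => ?_, fun v => ?_⟩
  · rw [freeLift_apply]
    rw [mem_freeGrading] at hv
    exact sum_mem fun k _ => smul_mem_freeGrading (hθ _ _ (hv k)) (ha k) (by ring)
  · rw [semilinear_apply _ t v, freeLift_apply, map_sum]
    simp [hDa]

/-- If `g ∘ f` is the identity modulo the maximal ideal, `f` and `g` graded, then in each degree
the source of `f` has at most as many basis vectors as its target. -/
theorem card_le_card_of_comp_congr_id (ι : MvPolynomial σ K →+* MvPolynomial τ K)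
    (π : MvPolynomial τ K →+* MvPolynomial σ K)
    (hπ : ∀ p, constantCoeff (π p) = constantCoeff p) {r r' : ℕ} (d : Fin r → ℤ)
    (d' : Fin r' → ℤ) (f : (Fin r → MvPolynomial σ K) →ₛₗ[ι] (Fin r' → MvPolynomial τ K))
    (g : (Fin r' → MvPolynomial τ K) →ₛₗ[π] (Fin r → MvPolynomial σ K))
    (hf : ∀ j, ∀ v ∈ freeGrading K σ d j, f v ∈ freeGrading K τ d' j)
    (hgf : ∀ v k, constantCoeff (g (f v) k) = constantCoeff (v k)) (j : ℤ) :
    Fintype.card {k : Fin r // d k = j} ≤ Fintype.card {k : Fin r' // d' k = j} := by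
  let a (l : Fin r') (k : Fin r) : K := constantCoeff (f (Pi.single k 1) l)
  let b (m : Fin r) (l : Fin r') : K := constantCoeff (g (Pi.single l 1) m)
  -- The entry of `f` at `(l, k)` is homogeneous of degree `d k - d' l`, so it has a constant term
  -- only when the two degrees agree.
  have ha (l : Fin r') (k : Fin r) (h : d k ≠ d' l) : a l k = 0 :=
    constantCoeff_eq_zero_of_mem_stdGrading K τ (mem_freeGrading.1 (hf (d k) _
      (single_mem_freeGrading k (one_mem_stdGrading K σ (sub_self _)))) l) (sub_ne_zero.2 h)
  have hab (m k : Fin r) : ∑ l, b m l * a l k = if m = k then 1 else 0 := by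
    have := hgf (Pi.single k 1) m
    rw [semilinear_apply _ g, Finset.sum_apply, map_sum] at this
    simp only [Pi.smul_apply, smul_eq_mul, map_mul, hπ] at this
    rw [Finset.sum_congr rfl fun l _ => mul_comm (b m l) (a l k)]
    refine this.trans ?_
    by_cases h : m = k
    · subst h; simp
    · simp [h]
  let A : Matrix {k : Fin r' // d' k = j} {k : Fin r // d k = j} K := fun l k => a l k
  let B : Matrix {k : Fin r // d k = j} {k : Fin r' // d' k = j} K := fun m l => b m l
  have hBA : B * A = 1 := by
    ext m k
    rw [Matrix.mul_apply, Matrix.one_apply]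
    simp only [Subtype.ext_iff, ← hab, A, B]
    rw [← Finset.sum_subtype (Finset.univ.filter fun l => d' l = j) (by simp)
      fun l => b m l * a l k]
    refine Finset.sum_subset (Finset.subset_univ _) fun l _ hl => ?_
    rw [ha l k (fun h => hl (by simp [← h, k.2])), mul_zero]
  calc Fintype.card {k : Fin r // d k = j} = (B * A).rank := by rw [hBA, Matrix.rank_one]
    _ ≤ B.rank := Matrix.rank_mul_le_left B A
    _ ≤ _ := Matrix.rank_le_card_width B

end GradedLift

/-! ### Comparison of minimal resolutions along a retract -/

section Comparison

variable {K σ τ M M' : Type*} [Field K] [AddCommGroup M] [Module K M]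
  [Module (MvPolynomial σ K) M] [AddCommGroup M'] [Module K M'] [Module (MvPolynomial τ K) M']
  {ℳ : ℤ → Submodule K M} {ℳ' : ℤ → Submodule K M'}

theorem MinGradedFreeRes.exists_aug_eq (F : MinGradedFreeRes (σ := σ) ℳ) (P : Projections ℳ)
    {j : ℤ} {y : M} (hy : y ∈ ℳ j) : ∃ x ∈ freeGrading K σ (F.deg 0) j, F.aug x = y :=
  (freeProjections K σ (F.deg 0)).exists_mem_of_mem P F.aug.toAddMonoidHom F.aug_mem hy
    (F.aug_surjective y)

theorem MinGradedFreeRes.exists_diff_eq (F : MinGradedFreeRes (σ := σ) ℳ) {i : ℕ}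
    {j : ℤ} {y : Fin (F.rank i) → MvPolynomial σ K} (hy : y ∈ freeGrading K σ (F.deg i) j)
    (h : ∃ x, F.diff i x = y) : ∃ x ∈ freeGrading K σ (F.deg (i + 1)) j, F.diff i x = y :=
  (freeProjections K σ (F.deg (i + 1))).exists_mem_of_mem (freeProjections K σ (F.deg i))
    (F.diff i).toAddMonoidHom (F.diff_mem i) hy h

variable (ι : MvPolynomial σ K →+* MvPolynomial τ K) (π : MvPolynomial τ K →+* MvPolynomial σ K)

/-- The lifts `f` and `g` of `φ` and `ψ` to the `i`-th free modules, and the homotopy `s` between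
`g ∘ f` and the identity. -/
theorem MinGradedFreeRes.exists_comparison [RingHomCompTriple ι π (RingHom.id _)]
    (hι : ∀ j, ∀ p ∈ stdGrading K σ j, ι p ∈ stdGrading K τ j)
    (hπ : ∀ j, ∀ p ∈ stdGrading K τ j, π p ∈ stdGrading K σ j)
    (F : MinGradedFreeRes (σ := σ) ℳ) (F' : MinGradedFreeRes (σ := τ) ℳ')
    (P : Projections ℳ) (P' : Projections ℳ') (φ : M →ₛₗ[ι] M') (ψ : M' →ₛₗ[π] M)
    (hφ : ∀ j, ∀ m ∈ ℳ j, φ m ∈ ℳ' j) (hψ : ∀ j, ∀ m ∈ ℳ' j, ψ m ∈ ℳ j)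
    (hψφ : ∀ m, ψ (φ m) = m) (i : ℕ) :
    ∃ (f : (Fin (F.rank i) → MvPolynomial σ K) →ₛₗ[ι] (Fin (F'.rank i) → MvPolynomial τ K))
      (g : (Fin (F'.rank i) → MvPolynomial τ K) →ₛₗ[π] (Fin (F.rank i) → MvPolynomial σ K))
      (s : (Fin (F.rank i) → MvPolynomial σ K) →ₗ[MvPolynomial σ K]
        (Fin (F.rank (i + 1)) → MvPolynomial σ K)),
      (∀ j, ∀ v ∈ freeGrading K σ (F.deg i) j, f v ∈ freeGrading K τ (F'.deg i) j) ∧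
      (∀ j, ∀ v ∈ freeGrading K τ (F'.deg i) j, g v ∈ freeGrading K σ (F.deg i) j) ∧
      (∀ w, ∃ x, F'.diff i x = f (F.diff i w)) ∧ (∀ w, ∃ x, F.diff i x = g (F'.diff i w)) ∧
      (∀ v k, constantCoeff ((g (f v) - v - F.diff i (s v)) k) = 0) ∧
      (∀ w, g (f (F.diff i w)) - F.diff i w = F.diff i (s (F.diff i w))) := by
  -- The induction carries two consequences of the homotopy formula `g f - 1 = d s + s' d`, with
  -- `s'` the previous homotopy: modulo the maximal ideal the term `s' d` vanishes by minimality,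
  -- and on the image of `d` it vanishes exactly because `d d = 0`. The latter is what allows the
  -- next homotopy to be built.
  induction i with
  | zero =>
    obtain ⟨f, hf, hf'⟩ := exists_graded_lift ι hι (F.deg 0) (F'.deg 0) F'.aug (φ.comp F.aug)
      fun j v hv => F'.exists_aug_eq P' (hφ j _ (F.aug_mem j v hv))
    obtain ⟨g, hg, hg'⟩ := exists_graded_lift π hπ (F'.deg 0) (F.deg 0) F.aug (ψ.comp F'.aug)
      fun j v hv => F.exists_aug_eq P (hψ j _ (F'.aug_mem j v hv))
    -- Since `π ∘ ι` is the identity, `g ∘ f` is genuinely linear and the identity can be subtracted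
    -- from it.
    obtain ⟨s, hs⟩ := exists_linear_lift (F.diff 0) (g.comp f - LinearMap.id) fun v =>
      (F.exact_aug _).1 (by simp [hg', hf', hψφ])
    have hs' : ∀ v, g (f v) - v = F.diff 0 (s v) := fun v => (hs v).symm
    refine ⟨f, g, s, hf, hg, fun w => (F'.exact_aug _).1 ?_, fun w => (F.exact_aug _).1 ?_,
      fun v k => ?_, fun w => hs' _⟩
    · simp [hf', F.exact_aug.apply_apply_eq_zero]
    · simp [hg', F'.exact_aug.apply_apply_eq_zero]
    · simp [hs']
  | succ i ih =>
    obtain ⟨f₀, g₀, s₀, hf₀, hg₀, hf₀', hg₀', -, hs₀⟩ := ih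
    obtain ⟨f, hf, hf'⟩ := exists_graded_lift ι hι (F.deg (i + 1)) (F'.deg (i + 1)) (F'.diff i)
      (f₀.comp (F.diff i)) fun j v hv =>
        F'.exists_diff_eq (hf₀ j _ (F.diff_mem i j v hv)) (hf₀' v)
    obtain ⟨g, hg, hg'⟩ := exists_graded_lift π hπ (F'.deg (i + 1)) (F.deg (i + 1)) (F.diff i)
      (g₀.comp (F'.diff i)) fun j v hv =>
        F.exists_diff_eq (hg₀ j _ (F'.diff_mem i j v hv)) (hg₀' v)
    simp only [LinearMap.comp_apply] at hf' hg'
    obtain ⟨s, hs⟩ := exists_linear_lift (F.diff (i + 1))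
      (g.comp f - LinearMap.id - s₀.comp (F.diff i)) fun v =>
      (F.exact_diff i _).1 (by simp [hg', hf', ← hs₀])
    have hs' : ∀ v, g (f v) - v - s₀ (F.diff i v) = F.diff (i + 1) (s v) := fun v => (hs v).symm
    refine ⟨f, g, s, hf, hg, fun w => (F'.exact_diff i _).1 ?_,
      fun w => (F.exact_diff i _).1 ?_, fun v k => ?_, fun w => ?_⟩
    · simp [hf', (F.exact_diff i).apply_apply_eq_zero]
    · simp [hg', (F'.exact_diff i).apply_apply_eq_zero]
    -- What remains is `s₀ (d v)`: the entries of `d v` have no constant term, and linearity of `s₀`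
    -- preserves this.
    · rw [← hs', sub_sub_cancel, semilinear_apply _ s₀, Finset.sum_apply, map_sum]
      refine Finset.sum_eq_zero fun l _ => ?_
      have := (mem_span_X_iff K σ _).1 (F.minimal i v l)
      simp [this]
    · rw [← hs', (F.exact_diff i).apply_apply_eq_zero, map_zero, sub_zero]

/-- Betti numbers do not increase when passing to a graded retract. -/
theorem MinGradedFreeRes.betti_le_of_retract [RingHomCompTriple ι π (RingHom.id _)]
    (hι : ∀ j, ∀ p ∈ stdGrading K σ j, ι p ∈ stdGrading K τ j)
    (hπ : ∀ j, ∀ p ∈ stdGrading K τ j, π p ∈ stdGrading K σ j)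
    (hπ₀ : ∀ p, constantCoeff (π p) = constantCoeff p)
    (F : MinGradedFreeRes (σ := σ) ℳ) (F' : MinGradedFreeRes (σ := τ) ℳ')
    (P : Projections ℳ) (P' : Projections ℳ') (φ : M →ₛₗ[ι] M') (ψ : M' →ₛₗ[π] M)
    (hφ : ∀ j, ∀ m ∈ ℳ j, φ m ∈ ℳ' j) (hψ : ∀ j, ∀ m ∈ ℳ' j, ψ m ∈ ℳ j)
    (hψφ : ∀ m, ψ (φ m) = m) (i : ℕ) (j : ℤ) : F.betti i j ≤ F'.betti i j := by
  obtain ⟨f, g, s, hf, hg, -, -, h, -⟩ :=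
    MinGradedFreeRes.exists_comparison ι π hι hπ F F' P P' φ ψ hφ hψ hψφ i
  refine card_le_card_of_comp_congr_id ι π hπ₀ (F.deg i) (F'.deg i) f g hf (fun v k => ?_) j
  have h₁ := h v k
  have h₂ := (mem_span_X_iff K σ _).1 (F.minimal i (s v) k)
  simpa [h₂, sub_eq_zero] using h₁

end Comparison

/-! ### Existence of minimal graded free resolutions -/

section Existence

variable {K σ : Type*} [Field K]

/-- A finite family of homogeneous generators of a submodule of a graded free module. -/
def IsHomogeneousGenerators {r : ℕ} (d : Fin r → ℤ)
    (N : Submodule (MvPolynomial σ K) (Fin r → MvPolynomial σ K)) {n : ℕ}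
    (a : Fin n → Fin r → MvPolynomial σ K) (e : Fin n → ℤ) : Prop :=
  (∀ k, a k ∈ freeGrading K σ d (e k)) ∧ Submodule.span (MvPolynomial σ K) (Set.range a) = N

theorem exists_isHomogeneousGenerators [Finite σ] {r : ℕ} (d : Fin r → ℤ)
    (N : Submodule (MvPolynomial σ K) (Fin r → MvPolynomial σ K))
    (hN : ∀ v ∈ N, ∀ j, (freeProjections K σ d).proj j v ∈ N) :
    ∃ (n : ℕ) (a : Fin n → Fin r → MvPolynomial σ K) (e : Fin n → ℤ),
      IsHomogeneousGenerators d N a e := by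
  have hspan : Submodule.span (MvPolynomial σ K)
      {v | v ∈ N ∧ ∃ j, v ∈ freeGrading K σ d j} = N := by
    refine le_antisymm (Submodule.span_le.2 fun v hv => hv.1) fun v hv => ?_
    obtain ⟨s, hs⟩ := (freeProjections K σ d).exists_sum_proj v
    rw [← hs]
    exact sum_mem fun j _ => Submodule.subset_span
      ⟨hN v hv j, j, (freeProjections K σ d).proj_mem j v⟩
  have hfg := IsNoetherian.noetherian N
  rw [← hspan, Submodule.fg_span_iff_fg_span_finset_subset] at hfg
  obtain ⟨S, hS, hSN⟩ := hfg
  rw [hspan] at hSN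
  choose e he using fun k => (hS (S.equivFin.symm k).2).2
  refine ⟨S.card, fun k => S.equivFin.symm k, e, he, ?_⟩
  rw [hSN]
  congr 1
  ext v
  refine ⟨?_, fun hv => ⟨S.equivFin ⟨v, hv⟩, by simp⟩⟩
  rintro ⟨k, rfl⟩
  exact (S.equivFin.symm k).2

/-- In a homogeneous generating family, a generator that occurs with a unit coefficient in a
relation is redundant. -/
theorem IsHomogeneousGenerators.succAbove {r : ℕ} {d : Fin r → ℤ}
    {N : Submodule (MvPolynomial σ K) (Fin r → MvPolynomial σ K)} {n : ℕ}
    {a : Fin (n + 1) → Fin r → MvPolynomial σ K} {e : Fin (n + 1) → ℤ}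
    (h : IsHomogeneousGenerators d N a e) (v : Fin (n + 1) → MvPolynomial σ K)
    (hv : ∑ k, v k • a k = 0) (k : Fin (n + 1)) (hk : constantCoeff (v k) ≠ 0) :
    IsHomogeneousGenerators d N (a ∘ k.succAbove) (e ∘ k.succAbove) := by
  refine ⟨fun l => h.1 _, ?_⟩
  have hsub : Submodule.span (MvPolynomial σ K) (Set.range (a ∘ k.succAbove)) ≤ N := by
    rw [← h.2]
    exact Submodule.span_mono (Set.range_comp_subset_range _ _)
  refine le_antisymm hsub ?_
  rw [← h.2, Submodule.span_le, Set.range_subset_iff, Fin.forall_iff_succAbove k]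
  refine ⟨?_, fun l => Submodule.subset_span ⟨l, rfl⟩⟩
  -- The component of the relation in degree `e k`. Its coefficient at `k` has degree `0`, so it is
  -- the nonzero scalar `constantCoeff (v k)`, and the relation can be solved for `a k`.
  let w : Fin (n + 1) → MvPolynomial σ K := fun l => (stdProjections K σ).proj (e k - e l) (v l)
  have hw : ∑ l, w l • a l = 0 := by
    have := congrArg ((freeProjections K σ d).proj (e k)) hv
    rw [map_sum, map_zero] at this
    rw [← this]
    refine Finset.sum_congr rfl fun l _ => ?_
    have := (stdProjections K σ).map_proj_add (freeProjections K σ d)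
      ((LinearMap.toSpanSingleton (MvPolynomial σ K) _ (a l)).toAddMonoidHom) (e l)
      (fun i p hp => smul_mem_freeGrading hp (h.1 l) rfl) (e k - e l) (v l)
    simpa using this
  have hwk : w k = C (constantCoeff (v k)) := by
    classical
    ext m
    simp only [w, stdProjections, sub_self]
    change coeff m (weightedHomogeneousComponent _ 0 (v k)) = _
    rw [coeff_weightedHomogeneousComponent, coeff_C, constantCoeff_eq]
    have : Finsupp.weight (fun _ : σ => (1 : ℤ)) m = (m.degree : ℤ) := by
      simp [Finsupp.weight_apply, Finsupp.sum, Finsupp.degree_apply]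
    simp only [this, Nat.cast_eq_zero, Finsupp.degree_eq_zero_iff]
    by_cases hm : m = 0
    · simp [hm]
    · simp [hm, Ne.symm hm]
  rw [Fin.sum_univ_succAbove _ k, hwk, ← eq_neg_iff_add_eq_zero] at hw
  have hak : a k = (C (constantCoeff (v k))⁻¹ : MvPolynomial σ K) •
      (C (constantCoeff (v k)) : MvPolynomial σ K) • a k := by
    rw [smul_smul, ← C_mul, inv_mul_cancel₀ hk, C_1, one_smul]
  rw [hak, hw]
  exact Submodule.smul_mem _ _ (neg_mem (sum_mem fun l _ =>
    Submodule.smul_mem _ _ (Submodule.subset_span ⟨l, rfl⟩)))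

/-- A homogeneous submodule of a graded free module has a minimal graded free cover. -/
theorem exists_minimal_cover [Finite σ] {r : ℕ} (d : Fin r → ℤ)
    (N : Submodule (MvPolynomial σ K) (Fin r → MvPolynomial σ K))
    (hN : ∀ v ∈ N, ∀ j, (freeProjections K σ d).proj j v ∈ N) :
    ∃ (n : ℕ) (e : Fin n → ℤ)
      (D : (Fin n → MvPolynomial σ K) →ₗ[MvPolynomial σ K] (Fin r → MvPolynomial σ K)),
      LinearMap.range D = N ∧
      (∀ j, ∀ v ∈ freeGrading K σ e j, D v ∈ freeGrading K σ d j) ∧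
      ∀ v, D v = 0 → ∀ k, constantCoeff (v k) = 0 := by
  classical
  have hex := exists_isHomogeneousGenerators d N hN
  obtain ⟨a, e, h⟩ := Nat.find_spec hex
  -- The cover uses the least possible number of homogeneous generators; a relation with a nonzero
  -- constant term would allow one of them to be dropped.
  have hmin := fun m => Nat.find_min hex (m := m)
  generalize Nat.find hex = n at a e h hmin
  refine ⟨n, e, Fintype.linearCombination (MvPolynomial σ K) a, ?_, fun j v hv => ?_,
    fun v hv k => ?_⟩
  · rw [Fintype.range_linearCombination, h.2]
  · rw [Fintype.linearCombination_apply]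
    rw [mem_freeGrading] at hv
    exact sum_mem fun k _ => smul_mem_freeGrading (hv k) (h.1 k) (by ring)
  · by_contra hk
    cases n with
    | zero => exact k.elim0
    | succ n => exact hmin n (Nat.lt_succ_self n) ⟨_, _, h.succAbove v hv k hk⟩

variable (K σ) in
/-- A homogeneous submodule, contained in the maximal ideal times `F`, of a graded free module `F`
of finite rank. -/
structure Syzygy where
  /-- the rank of the free module -/
  rank : ℕ
  /-- the degrees of the basis vectors -/
  deg : Fin rank → ℤ
  /-- the submodule -/
  mod : Submodule (MvPolynomial σ K) (Fin rank → MvPolynomial σ K)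
  proj_mem : ∀ v ∈ mod, ∀ j, (freeProjections K σ deg).proj j v ∈ mod
  constantCoeff_eq_zero : ∀ v ∈ mod, ∀ k, constantCoeff (v k) = 0

namespace Syzygy

variable [Finite σ] (S : Syzygy K σ)

/-- The kernel of a minimal cover is homogeneous because the cover is graded, and has no constant
terms by minimality. It is therefore a `Syzygy` again, and the construction iterates. -/
theorem exists_next : ∃ (T : Syzygy K σ)
    (D : (Fin T.rank → MvPolynomial σ K) →ₗ[MvPolynomial σ K] (Fin S.rank → MvPolynomial σ K)),
    LinearMap.range D = S.mod ∧ LinearMap.ker D = T.mod ∧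
      ∀ j, ∀ v ∈ freeGrading K σ T.deg j, D v ∈ freeGrading K σ S.deg j := by
  obtain ⟨n, e, D, hD, hgr, hker⟩ := exists_minimal_cover S.deg S.mod S.proj_mem
  refine ⟨⟨n, e, LinearMap.ker D, fun v hv j => ?_, hker⟩, D, hD, rfl, hgr⟩
  have := (freeProjections K σ e).map_proj (freeProjections K σ S.deg) D.toAddMonoidHom hgr j v
  rw [LinearMap.mem_ker] at hv ⊢
  simpa [hv] using this

/-- The syzygies of the given syzygy module. -/
def next : Syzygy K σ := S.exists_next.choose

/-- The minimal cover of the syzygy module. -/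
def cover : (Fin S.next.rank → MvPolynomial σ K) →ₗ[MvPolynomial σ K]
    (Fin S.rank → MvPolynomial σ K) := S.exists_next.choose_spec.choose

theorem range_cover : LinearMap.range S.cover = S.mod :=
  S.exists_next.choose_spec.choose_spec.1

theorem ker_cover : LinearMap.ker S.cover = S.next.mod :=
  S.exists_next.choose_spec.choose_spec.2.1

theorem cover_mem : ∀ j, ∀ v ∈ freeGrading K σ S.next.deg j, S.cover v ∈ freeGrading K σ S.deg j :=
  S.exists_next.choose_spec.choose_spec.2.2

/-- The iterated syzygies. -/
def iter : ℕ → Syzygy K σ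
  | 0 => S
  | i + 1 => (iter i).next

/-- The minimal graded free resolution of the quotient of a graded free module by a homogeneous
submodule. -/
def resolution {M : Type*} [AddCommGroup M] [Module K M] [Module (MvPolynomial σ K) M]
    {ℳ : ℤ → Submodule K M}
    (aug : (Fin S.rank → MvPolynomial σ K) →ₗ[MvPolynomial σ K] M)
    (haug : ∀ j, ∀ v ∈ freeGrading K σ S.deg j, aug v ∈ ℳ j) (hsurj : Function.Surjective aug)
    (hker : LinearMap.ker aug = S.mod) : MinGradedFreeRes (σ := σ) ℳ where
  rank i := (S.iter i).rank
  deg i := (S.iter i).deg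
  diff i := (S.iter i).cover
  aug := aug
  diff_mem i := (S.iter i).cover_mem
  aug_mem := haug
  aug_surjective := hsurj
  exact_aug := (LinearMap.exact_iff (f := S.cover)).2 (hker.trans S.range_cover.symm)
  exact_diff i := (LinearMap.exact_iff (f := (S.iter i).next.cover)).2
    ((S.iter i).ker_cover.trans (S.iter i).next.range_cover.symm)
  minimal i v k := (mem_span_X_iff K σ _).2 ((S.iter i).constantCoeff_eq_zero _
    ((S.iter i).range_cover ▸ LinearMap.mem_range_self _ v) k)

end Syzygy

theorem nonempty_minGradedFreeRes_quotient [Finite σ] (I : Ideal (MvPolynomial σ K))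
    (hI : ∀ p ∈ I, ∀ j, (stdProjections K σ).proj j p ∈ I)
    (hI₀ : ∀ p ∈ I, constantCoeff p = 0) :
    Nonempty (MinGradedFreeRes (σ := σ) (quotientGrading I)) := by
  let S : Syzygy K σ :=
    { rank := 1
      deg := fun _ => 0
      mod := Submodule.comap
        (LinearMap.proj (R := MvPolynomial σ K) (φ := fun _ : Fin 1 => MvPolynomial σ K) 0) I
      proj_mem := fun v hv j => hI _ hv _
      constantCoeff_eq_zero := fun v hv k => by
        rw [Subsingleton.elim k 0]
        exact hI₀ _ hv }
  refine ⟨S.resolution (I.mkQ.comp (LinearMap.proj 0)) (fun j v hv => ?_) ?_ ?_⟩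
  · exact ⟨v 0, by simpa [S] using mem_freeGrading.1 hv 0, rfl⟩
  · exact I.mkQ_surjective.comp (Function.surjective_eval 0)
  · rw [LinearMap.ker_comp, Submodule.ker_mkQ]

end Existence

/-! ### Parity ideals and the retraction onto an induced subgraph -/

section ParityIdeal

attribute [local instance] weightedGradedAlgebra

variable (K : Type*) [Field K] {V : Type*}

theorem proj_mem_parityIdeal (G : SimpleGraph V) : ∀ p ∈ parityIdeal K G, ∀ j,
    (stdProjections K (V ⊕ V)).proj j p ∈ parityIdeal K G := by
  intro p hp j
  refine weightedHomogeneousComponent_mem_of_mem K _ (Ideal.homogeneous_span _ _ ?_) hp j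
  rintro _ ⟨u, v, -, rfl⟩
  exact ⟨2, sub_mem (mul_mem_stdGrading K _ (X_mem_stdGrading K _ _) (X_mem_stdGrading K _ _)
    (by norm_num)) (mul_mem_stdGrading K _ (X_mem_stdGrading K _ _) (X_mem_stdGrading K _ _)
    (by norm_num))⟩

theorem constantCoeff_of_mem_parityIdeal (G : SimpleGraph V) :
    ∀ p ∈ parityIdeal K G, constantCoeff p = 0 := by
  suffices h : parityIdeal K G ≤ RingHom.ker constantCoeff from fun p hp => h hp
  rw [parityIdeal, Ideal.span_le]
  rintro _ ⟨u, v, -, rfl⟩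
  simp

/-- The inclusion of the polynomial ring on the vertices in `A`. -/
def inclusion (A : Set V) : XYRing K A →ₐ[K] XYRing K V :=
  aeval (X ∘ Sum.map Subtype.val Subtype.val)

open scoped Classical in
/-- The images of the variables under the retraction that kills the variables outside `A`. -/
def retractionVar (A : Set V) : V ⊕ V → XYRing K A :=
  Sum.elim (fun v => if h : v ∈ A then X (Sum.inl ⟨v, h⟩) else 0)
    (fun v => if h : v ∈ A then X (Sum.inr ⟨v, h⟩) else 0)

/-- The retraction that kills the variables outside `A`. -/
def retraction (A : Set V) : XYRing K V →ₐ[K] XYRing K A := aeval (retractionVar K A)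

variable {K}

theorem retraction_inclusion (A : Set V) (p : XYRing K A) :
    retraction K A (inclusion K A p) = p := by
  suffices h : (retraction K A).comp (inclusion K A) = AlgHom.id K _ from DFunLike.congr_fun h p
  ext s
  rcases s with s | s <;> simp [retraction, inclusion, retractionVar]

theorem inclusion_mem_stdGrading (A : Set V) (j : ℤ) :
    ∀ p ∈ stdGrading K (A ⊕ A) j, inclusion K A p ∈ stdGrading K (V ⊕ V) j := fun _ hp =>
  aeval_mem_stdGrading _ (fun _ => X_mem_stdGrading K _ _) hp

theorem retractionVar_mem_stdGrading (A : Set V) (s : V ⊕ V) :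
    retractionVar K A s ∈ stdGrading K (A ⊕ A) 1 := by
  rcases s with s | s <;> simp only [retractionVar, Sum.elim_inl, Sum.elim_inr] <;> split_ifs
  all_goals first | exact X_mem_stdGrading K _ _ | exact zero_mem _

theorem retraction_mem_stdGrading (A : Set V) (j : ℤ) :
    ∀ p ∈ stdGrading K (V ⊕ V) j, retraction K A p ∈ stdGrading K (A ⊕ A) j := fun _ hp =>
  aeval_mem_stdGrading _ (retractionVar_mem_stdGrading A) hp

theorem constantCoeff_retraction (A : Set V) (p : XYRing K V) :
    constantCoeff (retraction K A p) = constantCoeff p := by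
  suffices h : (constantCoeff (R := K)).comp (retraction K A).toRingHom = constantCoeff from
    DFunLike.congr_fun h p
  ext s
  · simp [retraction]
  · simpa [retraction] using constantCoeff_eq_zero_of_mem_stdGrading K _
      (retractionVar_mem_stdGrading (K := K) A s) one_ne_zero

theorem inclusion_mem_parityIdeal (G : SimpleGraph V) (A : Set V) :
    parityIdeal K (G.induce A) ≤ (parityIdeal K G).comap (inclusion K A).toRingHom := by
  rw [parityIdeal, Ideal.span_le]
  rintro _ ⟨u, v, huv, rfl⟩
  exact Ideal.subset_span ⟨u, v, huv, by simp [inclusion]⟩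

/-- An edge inside `A` is an edge of the induced subgraph. For any other edge, both monomials of the
generator contain a variable at an endpoint outside `A`, so the generator maps to `0`. -/
theorem retraction_mem_parityIdeal (G : SimpleGraph V) (A : Set V) :
    parityIdeal K G ≤ (parityIdeal K (G.induce A)).comap (retraction K A).toRingHom := by
  rw [parityIdeal, Ideal.span_le]
  rintro _ ⟨u, v, huv, rfl⟩
  by_cases hu : u ∈ A
  · by_cases hv : v ∈ A
    · exact Ideal.subset_span ⟨⟨u, hu⟩, ⟨v, hv⟩, huv, by simp [retraction, retractionVar, hu, hv]⟩
    · simp [retraction, retractionVar, hv]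
  · simp [retraction, retractionVar, hu]

/-- A ring homomorphism that maps `I` into `J` induces a semilinear map of the quotients. -/
def quotientSemilinear {R R' : Type*} [CommRing R] [CommRing R'] (θ : R →+* R') {I : Ideal R}
    {J : Ideal R'} (h : I ≤ J.comap θ) : (R ⧸ I) →ₛₗ[θ] (R' ⧸ J) where
  toFun := Ideal.quotientMap J θ h
  map_add' := map_add _
  map_smul' c x := by
    obtain ⟨x, rfl⟩ := Ideal.Quotient.mk_surjective x
    rw [Algebra.smul_def, Algebra.smul_def, map_mul]
    rfl

theorem quotientSemilinear_mem {σ τ : Type*} (θ : MvPolynomial σ K →+* MvPolynomial τ K)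
    (hθ : ∀ j, ∀ p ∈ stdGrading K σ j, θ p ∈ stdGrading K τ j) {I : Ideal (MvPolynomial σ K)}
    {J : Ideal (MvPolynomial τ K)} (h : I ≤ J.comap θ) (j : ℤ) :
    ∀ m ∈ quotientGrading I j, quotientSemilinear θ h m ∈ quotientGrading J j := by
  rintro _ ⟨p, hp, rfl⟩
  exact ⟨θ p, hθ j p hp, rfl⟩

end ParityIdeal

end ParityBinomial

end

theorem theorem3p5 {K : Type*} [Field K] {V : Type*} [Finite V] (G : SimpleGraph V)
    (A : Set V) (i : ℕ) (j : ℤ) :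
    ParityBinomial.parityBetti K (G.induce A) i j ≤ ParityBinomial.parityBetti K G i j := by
  open ParityBinomial in
  have hG := nonempty_minGradedFreeRes_quotient (parityIdeal K G) (proj_mem_parityIdeal K G)
    (constantCoeff_of_mem_parityIdeal K G)
  have hH := nonempty_minGradedFreeRes_quotient (parityIdeal K (G.induce A))
    (proj_mem_parityIdeal K _) (constantCoeff_of_mem_parityIdeal K _)
  -- Existence for `G` excludes the default value `0` on the right-hand side.
  rw [parityBetti, parityBetti, gradedBetti, gradedBetti, dif_pos hG, dif_pos hH]
  have : RingHomCompTriple (inclusion K A).toRingHom (retraction K A).toRingHom (RingHom.id _) :=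
    ⟨RingHom.ext (retraction_inclusion A)⟩
  refine MinGradedFreeRes.betti_le_of_retract (inclusion K A).toRingHom (retraction K A).toRingHom
    (inclusion_mem_stdGrading A) (retraction_mem_stdGrading A) (constantCoeff_retraction A) _ _
    (quotientProjections _ (proj_mem_parityIdeal K _))
    (quotientProjections _ (proj_mem_parityIdeal K _))
    (quotientSemilinear _ (inclusion_mem_parityIdeal G A))
    (quotientSemilinear _ (retraction_mem_parityIdeal G A))
    (quotientSemilinear_mem _ (inclusion_mem_stdGrading A) _)
    (quotientSemilinear_mem _ (retraction_mem_stdGrading A) _) (fun m => ?_) i j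
  obtain ⟨p, rfl⟩ := Ideal.Quotient.mk_surjective m
  exact congrArg (Ideal.Quotient.mk _) (retraction_inclusion A p)
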